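/- Let the scalar field be $\mathbb{R}$ or $\mathbb{C}$, let $\mu$ be a $\sigma$-finite measure (in particular, $\mu$ may be any finite measure), let $E$ be a Banach space containing a linear subspace isomorphic (linearly homeomorphic) to $c_0$, and let $Q\colon L^1(\mu)\to E$ be a bounded linear surjection. Then $\ker Q$ is uncomplemented in its second dual $(\ker Q)^{**}$; that is, there is no bounded linear projection of $(\ker Q)^{**}$ onto the canonical image of $\ker Q$ in $(\ker Q)^{**}$. In particular, if $A$ is an infinite set and $Q\colon L^1(\mu)\to c_0(A)$ is a bounded linear surjection, where $c_0(A)$ is the space of scalar functions on $A$ that tend to zero at infinity on the discrete set $A$, with the supremum norm, then $\ker Q$ is uncomplemented in its second dual. -/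

import Mathlib

open MeasureTheory
open scoped ZeroAtInfty

/-- A normed space `X`, identified with its canonical image in its second dual `X**`, is
complemented in `X**`: there is a bounded linear projection of `X**` onto that image. -/
def ComplementedInSecondDual (𝕜 : Type*) [RCLike 𝕜] (X : Type*) [NormedAddCommGroup X]
    [NormedSpace 𝕜 X] : Prop :=
  Submodule.ClosedComplemented (R := 𝕜) (M := StrongDual 𝕜 (StrongDual 𝕜 X))
    (NormedSpace.inclusionInDoubleDual 𝕜 X).range

/-- `E` has a linear subspace that is (linearly and topologically) isomorphic to `c₀`.
Here `C₀(ℕ, 𝕜)`, with `ℕ` discrete, is the space of scalar sequences that tend to zero, with the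
supremum norm. -/
def ContainsCopyOfCZero (𝕜 : Type*) [RCLike 𝕜] (E : Type*) [NormedAddCommGroup E]
    [NormedSpace 𝕜 E] : Prop :=
  ∃ E₁ : Submodule 𝕜 E, Nonempty (E₁ ≃L[𝕜] C₀(ℕ, 𝕜))

/-! Suppose ker Q is complemented in its second dual. Then bounded operators T : L¹[0,1] → E lift
through Q: choose lifts of bounded norm on dyadic intervals, then repair their additivity by a
generalized limit in ker Q (`exists_tree_lift`). Let T send the Rademacher function r_j to u_j,
where (u_j) is a block sequence in the copy of c₀, and let S be a lift. An operator between L¹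
spaces maps the unit ball of L^∞ into an order interval, so |S r_j| ≤ g for one integrable g. Order
intervals of L¹(μ) lie, up to ε, in Φ(ball) for a fixed Φ : L² → L¹(μ). Hence all u_j = Q S r_j lie
near QΦ(ball) for a single ball. But that set is weakly compact and c₀ is not weakly sequentially
complete, so u_j can be chosen far from QΦ(j·ball): a contradiction. Operators on L¹[0,1] are
encoded as additive dyadic trees. -/

/-! ### Generalized limits from a projection of the second dual -/

open Filter Topology in
set_option maxSynthPendingDepth 3 in
/-- A space complemented in its second dual carries a generalized limit on its bounded
sequences, obtained by projecting weak-star ultrafilter limits. -/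
lemma ComplementedInSecondDual.exists_limit {𝕜 : Type*} [RCLike 𝕜] {X : Type*}
    [NormedAddCommGroup X] [NormedSpace 𝕜 X] (h : ComplementedInSecondDual 𝕜 X) :
    ∃ C : ℝ, 0 ≤ C ∧ ∃ L : (ℕ → X) → X,
      (∀ (x : ℕ → X) (M : ℝ), (∀ n, ‖x n‖ ≤ M) → ‖L x‖ ≤ C * M) ∧
      (∀ (x y z : ℕ → X) (M N R : ℝ), (∀ n, ‖x n‖ ≤ M) → (∀ n, ‖y n‖ ≤ N) → (∀ n, ‖z n‖ ≤ R) →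
        (∀ᶠ n in atTop, z n = x n + y n) → L z = L x + L y) ∧
      (∀ c : X, L (fun _ => c) = c) := by
  classical
  obtain ⟨P₀, hP₀⟩ := h
  let P : StrongDual 𝕜 (StrongDual 𝕜 X) →L[𝕜] StrongDual 𝕜 (StrongDual 𝕜 X) :=
    (Submodule.subtypeL _).comp P₀
  have hP : ∀ x : X, P (NormedSpace.inclusionInDoubleDual 𝕜 X x) =
      NormedSpace.inclusionInDoubleDual 𝕜 X x := fun x => congrArg Subtype.val (hP₀ ⟨_, x, rfl⟩)
  let U : Ultrafilter ℕ := hyperfilter ℕ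
  have key : ∀ (x : ℕ → X) (M : ℝ), (∀ n, ‖x n‖ ≤ M) →
      ∃ Λ : StrongDual 𝕜 (StrongDual 𝕜 X), ‖Λ‖ ≤ M ∧
        ∀ φ : StrongDual 𝕜 X, Tendsto (fun n => φ (x n)) U (𝓝 (Λ φ)) := by
    intro x M hx
    have hc := WeakDual.isCompact_closedBall (𝕜 := 𝕜) (E := StrongDual 𝕜 X) 0 M
    let f : ℕ → WeakDual 𝕜 (StrongDual 𝕜 X) := fun n =>
      StrongDual.toWeakDual (NormedSpace.inclusionInDoubleDual 𝕜 X (x n))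
    have hf : ∀ n, f n ∈ WeakDual.toStrongDual ⁻¹'
        Metric.closedBall (0 : StrongDual 𝕜 (StrongDual 𝕜 X)) M := by
      intro n
      refine (mem_closedBall_zero_iff (E := StrongDual 𝕜 (StrongDual 𝕜 X))).2 ?_
      exact (NormedSpace.double_dual_bound 𝕜 X (x n)).trans (hx n)
    obtain ⟨Λ, hΛ, hlim⟩ := hc.ultrafilter_le_nhds (U.map f)
      (by
        rw [le_principal_iff]
        exact Eventually.of_forall (f := (U : Filter ℕ)) hf)
    refine ⟨WeakDual.toStrongDual Λ, by simpa using hΛ, fun φ => ?_⟩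
    have h1 : Tendsto f U (𝓝 Λ) := hlim
    exact ((WeakDual.eval_continuous φ).tendsto Λ).comp h1
  let ι := NormedSpace.inclusionInDoubleDual 𝕜 X
  have hι : ∀ x : X, ‖ι x‖ = ‖x‖ := fun x => (NormedSpace.inclusionInDoubleDualLi 𝕜).norm_map x
  -- The value 0 on unbounded sequences is junk. On bounded ones the choice is harmless, since
  -- ultrafilter limits are unique.
  let Λ : (ℕ → X) → StrongDual 𝕜 (StrongDual 𝕜 X) := fun x =>
    if hx : ∃ M : ℝ, ∀ n, ‖x n‖ ≤ M then (key x _ hx.choose_spec).choose else 0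
  have hΛ : ∀ (x : ℕ → X) (M : ℝ), (∀ n, ‖x n‖ ≤ M) →
      ∀ φ : StrongDual 𝕜 X, Tendsto (fun n => φ (x n)) U (𝓝 (Λ x φ)) := by
    intro x M hx φ
    have hx' : ∃ M : ℝ, ∀ n, ‖x n‖ ≤ M := ⟨M, hx⟩
    simp only [Λ, dif_pos hx']
    exact (key x _ hx'.choose_spec).choose_spec.2 φ
  have huniq : ∀ (x : ℕ → X) (M : ℝ), (∀ n, ‖x n‖ ≤ M) →
      ∀ Γ : StrongDual 𝕜 (StrongDual 𝕜 X),
      (∀ φ : StrongDual 𝕜 X, Tendsto (fun n => φ (x n)) U (𝓝 (Γ φ))) → Λ x = Γ := by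
    intro x M hx Γ hΓ
    ext φ
    exact tendsto_nhds_unique (hΛ x M hx φ) (hΓ φ)
  have hrange : ∀ Γ, ∃ x : X, ι x = P Γ := fun Γ => (P₀ Γ).2
  choose r hr using hrange
  have hinj : Function.Injective ι := (NormedSpace.inclusionInDoubleDualLi 𝕜).injective
  refine ⟨‖P‖, norm_nonneg _, fun x => r (Λ x), ?_, ?_, ?_⟩
  · intro x M hx
    obtain ⟨Γ, hΓ, hΓ'⟩ := key x M hx
    have := huniq x M hx Γ hΓ'
    rw [← hι, hr, this]
    exact (P.le_opNorm Γ).trans (by gcongr)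
  · intro x y z M N R hx hy hz hxyz
    have : Λ z = Λ x + Λ y := by
      refine huniq z R hz _ fun φ => ?_
      refine ((hΛ x M hx φ).add (hΛ y N hy φ)).congr' ?_
      have hU : (U : Filter ℕ) ≤ atTop := by
        rw [← Nat.cofinite_eq_atTop]; exact hyperfilter_le_cofinite
      filter_upwards [hU hxyz] with n hn
      rw [hn, map_add]
    apply hinj
    rw [map_add, hr, hr, hr, this, map_add]
  · intro c
    have : Λ (fun _ => c) = ι c :=
      huniq _ ‖c‖ (fun _ => le_rfl) _ fun φ => tendsto_const_nhds
    apply hinj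
    rw [hr, this]
    exact hP c

/-! ### Lifting dyadic trees through Q -/

/-- The sum of `a (n + m) j` over the descendants of the node `k` of level `n` in the binary tree,
`m` levels below it. -/
def descendantSum {Z : Type*} [Add Z] (a : ℕ → ℕ → Z) : ℕ → ℕ → ℕ → Z
  | 0, n, k => a n k
  | m + 1, n, k => descendantSum a m (n + 1) (2 * k) + descendantSum a m (n + 1) (2 * k + 1)

lemma norm_descendantSum_le {Z : Type*} [SeminormedAddCommGroup Z] {a : ℕ → ℕ → Z} {B : ℝ}
    (ha : ∀ n k, ‖a n k‖ ≤ B * (1 / 2) ^ n) (m n k : ℕ) :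
    ‖descendantSum a m n k‖ ≤ B * (1 / 2) ^ n := by
  induction m generalizing n k with
  | zero => exact ha n k
  | succ m ih =>
    refine (norm_add_le _ _).trans ((add_le_add (ih _ _) (ih _ _)).trans_eq ?_)
    ring

lemma map_descendantSum {𝕜 Z E : Type*} [Semiring 𝕜] [AddCommMonoid Z] [AddCommMonoid E]
    [Module 𝕜 Z] [Module 𝕜 E] (Q : Z →ₗ[𝕜] E) {a : ℕ → ℕ → Z} {t : ℕ → ℕ → E}
    (ht : ∀ n k, t n k = t (n + 1) (2 * k) + t (n + 1) (2 * k + 1))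
    (ha : ∀ n k, Q (a n k) = t n k) (m n k : ℕ) : Q (descendantSum a m n k) = t n k := by
  induction m generalizing n k with
  | zero => exact ha n k
  | succ m ih => rw [descendantSum, map_add, ih, ih, ← ht]

open Filter in
/-- Lifting of operators from `L¹[0, 1]` (given by their values on dyadic intervals) along a
quotient map whose kernel is complemented in its second dual. -/
lemma exists_tree_lift {𝕜 : Type*} [RCLike 𝕜] {Z E : Type*} [NormedAddCommGroup Z]
    [NormedSpace 𝕜 Z] [NormedAddCommGroup E] [NormedSpace 𝕜 E] (Q : Z →L[𝕜] E)
    (hK : ComplementedInSecondDual 𝕜 Q.ker) {C B : ℝ} (hC : 0 ≤ C)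
    (hQ : ∀ y, ∃ x, Q x = y ∧ ‖x‖ ≤ C * ‖y‖) (t : ℕ → ℕ → E)
    (ht : ∀ n k, t n k = t (n + 1) (2 * k) + t (n + 1) (2 * k + 1))
    (hB : ∀ n k, ‖t n k‖ ≤ B * (1 / 2) ^ n) :
    ∃ (s : ℕ → ℕ → Z) (B' : ℝ), (∀ n k, Q (s n k) = t n k) ∧
      (∀ n k, s n k = s (n + 1) (2 * k) + s (n + 1) (2 * k + 1)) ∧
      (∀ n k, ‖s n k‖ ≤ B' * (1 / 2) ^ n) := by
  obtain ⟨D, hD, L, hLb, hLadd, hLc⟩ := hK.exists_limit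
  choose f hfQ hfn using hQ
  let a : ℕ → ℕ → Z := fun n k => f (t n k)
  have haQ : ∀ n k, Q (a n k) = t n k := fun n k => hfQ _
  have han : ∀ n k, ‖a n k‖ ≤ (C * B) * (1 / 2) ^ n := fun n k =>
    (hfn _).trans (by rw [mul_assoc]; exact mul_le_mul_of_nonneg_left (hB n k) hC)
  have hker : ∀ n k N, descendantSum a (N - n) n k - a n k ∈ Q.ker := by
    intro n k N
    have h1 := map_descendantSum (Q : Z →ₗ[𝕜] E) ht haQ (N - n) n k
    have h2 := haQ n k
    simp only [ContinuousLinearMap.coe_coe] at h1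
    simp [LinearMap.mem_ker, h1, h2]
  -- Only ker Q has generalized limits, so the limit over N is taken of the correction to `a n k`.
  -- The truncated `N - n` matters only for N < n, which the limit ignores.
  let x : ℕ → ℕ → ℕ → Q.ker := fun n k N => ⟨_, hker n k N⟩
  have hx : ∀ n k N, ‖x n k N‖ ≤ 2 * (C * B) * (1 / 2) ^ n := by
    intro n k N
    have h1 := norm_descendantSum_le han (N - n) n k
    have h2 := han n k
    have h3 := norm_sub_le (descendantSum a (N - n) n k) (a n k)
    change ‖descendantSum a (N - n) n k - a n k‖ ≤ _
    linarith
  have hd : ∀ n k, a (n + 1) (2 * k) + a (n + 1) (2 * k + 1) - a n k ∈ Q.ker := by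
    intro n k
    have h1 := haQ n k
    have h2 := haQ (n + 1) (2 * k)
    have h3 := haQ (n + 1) (2 * k + 1)
    simp [LinearMap.mem_ker, h1, h2, h3, ht n k]
  refine ⟨fun n k => a n k + L (x n k), C * B + D * (2 * (C * B)), ?_, ?_, ?_⟩
  · intro n k
    have : Q (L (x n k) : Z) = 0 := (L (x n k)).2
    rw [map_add, this, add_zero, haQ]
  · intro n k
    have h1 := hLadd (x (n + 1) (2 * k)) (x (n + 1) (2 * k + 1))
      (fun N => x (n + 1) (2 * k) N + x (n + 1) (2 * k + 1) N) _ _ _ (hx _ _) (hx _ _)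
      (fun N => (norm_add_le _ _).trans (add_le_add (hx _ _ N) (hx _ _ N)))
      (Eventually.of_forall fun _ => rfl)
    have h2 := hLadd (fun N => x (n + 1) (2 * k) N + x (n + 1) (2 * k + 1) N)
      (fun _ => ⟨_, hd n k⟩) (x n k) _ _ _
      (fun N => (norm_add_le _ _).trans (add_le_add (hx _ _ N) (hx _ _ N)))
      (fun N => le_rfl) (hx _ _)
      (by
        filter_upwards [eventually_ge_atTop (n + 1)] with N hN
        obtain ⟨m, rfl⟩ := Nat.exists_eq_add_of_le hN
        apply Subtype.ext
        have e1 : n + 1 + m - n = m + 1 := by omega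
        have e2 : n + 1 + m - (n + 1) = m := by omega
        simp only [x, Submodule.coe_add, e1, e2, descendantSum]
        abel)
    rw [h1, hLc] at h2
    simp only [h2, Submodule.coe_add]
    abel
  · intro n k
    have h1 := hLb _ _ (hx n k)
    have h2 := han n k
    refine (norm_add_le _ _).trans ?_
    have : ‖(L (x n k) : Z)‖ ≤ D * (2 * (C * B) * (1 / 2) ^ n) := h1
    linarith

/-! ### Blocks of c₀ far from Hilbert balls -/

/-- For an embedding `J` of the finitely supported sequences with the sup norm and a bounded
operator `Φ` on a Hilbert space, the partial sums `1_{[n, m)}` leave a neighbourhood of the weakly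
compact image of each ball: `c₀` is not weakly sequentially complete. -/
lemma exists_indicator_far_from_image_closedBall {𝕜 : Type*} [RCLike 𝕜] {H E : Type*}
    [NormedAddCommGroup H] [InnerProductSpace 𝕜 H] [NormedAddCommGroup E] [NormedSpace 𝕜 E]
    (J : (ℕ →₀ 𝕜) →ₗ[𝕜] E) {c : ℝ} (hc : 0 < c) (hJ : ∀ a i, c * ‖a i‖ ≤ ‖J a‖)
    (Φ : H →L[𝕜] E) (R : ℝ) (n : ℕ) :
    ∃ m > n, ∀ h : H, ‖h‖ ≤ R →
      c / 4 < ‖J (Finsupp.indicator (Finset.Ico n m) fun _ _ => 1) - Φ h‖ := by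
  by_contra! hcon
  -- These sets decrease in N, are midpoint convex and meet the R-ball. By the parallelogram law,
  -- their almost minimal-norm points are close to each other for large N; this replaces weak
  -- compactness.
  let G : ℕ → Set H := fun N => {h | ∃ a : ℕ →₀ 𝕜, (∀ i, n ≤ i → i < N → a i = 1) ∧
    ‖J a - Φ h‖ ≤ c / 4}
  have hGne : ∀ N, ∃ h ∈ G N, ‖h‖ ≤ R := by
    intro N
    obtain ⟨h, hh, hle⟩ := hcon (max N (n + 1)) (by omega)
    refine ⟨h, ⟨_, fun i hi hiN => ?_, hle⟩, hh⟩
    rw [Finsupp.indicator_apply, dif_pos (by simp; omega)]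
  have hR : 0 ≤ R := by
    obtain ⟨h, -, hh⟩ := hGne 0
    exact (norm_nonneg h).trans hh
  have hGanti : ∀ {N N'}, N ≤ N' → G N' ⊆ G N := by
    rintro N N' hN h ⟨a, ha, hle⟩
    exact ⟨a, fun i hi hiN => ha i hi (hiN.trans_le hN), hle⟩
  have hGmid : ∀ N, ∀ p ∈ G N, ∀ q ∈ G N, (1 / 2 : 𝕜) • (p + q) ∈ G N := by
    rintro N p ⟨a, ha, hp⟩ q ⟨b, hb, hq⟩
    refine ⟨(1 / 2 : 𝕜) • (a + b), fun i hi hiN => ?_, ?_⟩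
    · simp only [Finsupp.smul_apply, Finsupp.add_apply, ha i hi hiN, hb i hi hiN, smul_eq_mul]
      norm_num
    · have : J ((1 / 2 : 𝕜) • (a + b)) - Φ ((1 / 2 : 𝕜) • (p + q)) =
          (1 / 2 : 𝕜) • ((J a - Φ p) + (J b - Φ q)) := by
        simp only [map_smul, map_add, ← smul_sub]; congr 1; abel
      rw [this, norm_smul]
      have h2 : ‖(1 / 2 : 𝕜)‖ = 1 / 2 := by simp
      rw [h2]
      linarith [norm_add_le (J a - Φ p) (J b - Φ q)]
  let d : ℕ → ℝ := fun N => sInf (norm '' G N)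
  have hbdd : ∀ N, BddBelow (norm '' G N) := fun N =>
    ⟨0, by rintro _ ⟨h, -, rfl⟩; exact norm_nonneg h⟩
  have hdle : ∀ N, ∀ h ∈ G N, d N ≤ ‖h‖ := fun N h hh => csInf_le (hbdd N) ⟨h, hh, rfl⟩
  have hdR : ∀ N, d N ≤ R := fun N => by
    obtain ⟨h, hh, hhR⟩ := hGne N
    exact (hdle N h hh).trans hhR
  have hdbdd : BddAbove (Set.range d) := ⟨R, by rintro _ ⟨N, rfl⟩; exact hdR N⟩
  have hdlt : ∀ N η, 0 < η → ∃ h ∈ G N, ‖h‖ < d N + η := by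
    intro N η hη
    obtain ⟨h, hh, -⟩ := hGne N
    obtain ⟨_, ⟨p, hp, rfl⟩, hlt⟩ := Real.lt_sInf_add_pos (s := norm '' G N) ⟨_, h, hh, rfl⟩ hη
    exact ⟨p, hp, hlt⟩
  let D := ⨆ N, d N
  have hdD : ∀ N, d N ≤ D := le_ciSup hdbdd
  have hDR : D ≤ R := ciSup_le hdR
  have hD0 : 0 ≤ D := (Real.sInf_nonneg (by rintro _ ⟨h, -, rfl⟩; exact norm_nonneg h)).trans (hdD 0)
  let δ := c / (4 * (‖Φ‖ + 1))
  have hδ : 0 < δ := by positivity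
  have hΦδ : ‖Φ‖ * δ < c / 2 := by
    have : (‖Φ‖ + 1) * δ = c / 4 := by simp only [δ]; field_simp
    nlinarith
  -- The parallelogram law will give ‖p − q‖² ≤ 16Dη + 4η².
  obtain ⟨η, hη, hη1, hηδ⟩ : ∃ η : ℝ, 0 < η ∧ η ≤ 1 ∧ (16 * R + 4) * η ≤ δ ^ 2 := by
    refine ⟨min 1 (δ ^ 2 / (16 * R + 4)), lt_min one_pos (by positivity), min_le_left _ _, ?_⟩
    calc (16 * R + 4) * min 1 (δ ^ 2 / (16 * R + 4))
        ≤ (16 * R + 4) * (δ ^ 2 / (16 * R + 4)) := by gcongr; exact min_le_right _ _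
      _ = δ ^ 2 := by field_simp
  obtain ⟨N, hN⟩ := exists_lt_of_lt_ciSup (show D - η < ⨆ N, d N by simp only [D]; linarith)
  obtain ⟨p, ⟨a, ha, hp⟩, hpD⟩ := hdlt N η hη
  -- Past the support of a, b is 1 where a is 0, so ‖J b − J a‖ ≥ c, although p and q are close.
  obtain ⟨N', hNN', j, hnj, hjN', haj⟩ :
      ∃ N' ≥ N, ∃ j, n ≤ j ∧ j < N' ∧ a j = 0 := by
    refine ⟨max (max N n) (a.support.sup id + 1) + 1, by omega,
      max (max N n) (a.support.sup id + 1), by omega, by omega, ?_⟩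
    by_contra hne
    have := Finset.le_sup (f := id) (Finsupp.mem_support_iff.2 hne)
    rw [id] at this
    omega
  obtain ⟨q, ⟨b, hb, hq⟩, hqD⟩ := hdlt N' η hη
  have hpG : p ∈ G N := ⟨a, ha, hp⟩
  have hqG : q ∈ G N := hGanti hNN' ⟨b, hb, hq⟩
  have hmid := hdle N _ (hGmid N p hpG q hqG)
  rw [norm_smul, show ‖(1 / 2 : 𝕜)‖ = 1 / 2 by simp] at hmid
  have hpar := parallelogram_law_with_norm 𝕜 p q
  have hpq : ‖p - q‖ ≤ δ := by
    have h1 : ‖p‖ < D + η := hpD.trans_le (by linarith [hdD N])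
    have h2 : ‖q‖ < D + η := hqD.trans_le (by linarith [hdD N'])
    have h3 : 2 * (D - η) < ‖p + q‖ := by linarith
    have h4 : ‖p‖ * ‖p‖ ≤ (D + η) * (D + η) := by gcongr
    have h5 : ‖q‖ * ‖q‖ ≤ (D + η) * (D + η) := by gcongr
    have h6 : 4 * (D * D - 2 * (D * η)) ≤ ‖p + q‖ * ‖p + q‖ := by
      rcases le_total η D with h | h
      · nlinarith [mul_self_le_mul_self (by linarith : 0 ≤ 2 * (D - η)) h3.le]
      · nlinarith [mul_self_nonneg ‖p + q‖]
    have h7 : D * η ≤ R * η := by gcongr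
    have h8 : η * η ≤ 1 * η := by gcongr
    have h9 : ‖p - q‖ ^ 2 ≤ δ ^ 2 := by nlinarith
    exact le_of_sq_le_sq h9 hδ.le
  have hlow := hJ (b - a) j
  rw [Finsupp.sub_apply, hb j hnj hjN', haj, sub_zero, norm_one, mul_one, map_sub] at hlow
  have hsplit : J b - J a = (J b - Φ q) - (J a - Φ p) - Φ (p - q) := by rw [map_sub]; abel
  have h1 := norm_sub_le ((J b - Φ q) - (J a - Φ p)) (Φ (p - q))
  have h2 := norm_sub_le (J b - Φ q) (J a - Φ p)
  have h3 := Φ.le_opNorm (p - q)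
  have h4 : ‖Φ‖ * ‖p - q‖ ≤ ‖Φ‖ * δ := by gcongr
  rw [hsplit] at hlow
  linarith

/-- A bounded-sums block sequence of `c₀` that eventually escapes the image of every ball under a
bounded operator `Φ` on a Hilbert space. -/
lemma exists_blocks_far_from_image_closedBall {𝕜 : Type*} [RCLike 𝕜] {H E : Type*}
    [NormedAddCommGroup H] [InnerProductSpace 𝕜 H] [NormedAddCommGroup E] [NormedSpace 𝕜 E]
    (J : (ℕ →₀ 𝕜) →ₗ[𝕜] E) {c C : ℝ} (hc : 0 < c) (hJ : ∀ a i, c * ‖a i‖ ≤ ‖J a‖)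
    (hJ' : ∀ a : ℕ →₀ 𝕜, (∀ i, ‖a i‖ ≤ 1) → ‖J a‖ ≤ C) (Φ : H →L[𝕜] E) :
    ∃ u : ℕ → E, (∀ (θ : ℕ → 𝕜) (n : ℕ), (∀ j, ‖θ j‖ ≤ 1) →
        ‖∑ j ∈ Finset.range n, θ j • u j‖ ≤ C) ∧
      ∀ (j : ℕ) (h : H), ‖h‖ ≤ j → c / 4 < ‖u j - Φ h‖ := by
  choose f hf hfar using fun (j n : ℕ) =>
    exists_indicator_far_from_image_closedBall J hc hJ Φ (j : ℝ) n
  let ν : ℕ → ℕ := fun j => Nat.rec (motive := fun _ => ℕ) 0 (fun j n => f j n) j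
  have hν : ∀ j, ν j < ν (j + 1) := fun j => hf j (ν j)
  let b : ℕ → ℕ →₀ 𝕜 := fun j => Finsupp.indicator (Finset.Ico (ν j) (ν (j + 1))) fun _ _ => 1
  refine ⟨fun j => J (b j), fun θ n hθ => ?_, fun j h hh => hfar j (ν j) h hh⟩
  have hsum : ∑ j ∈ Finset.range n, θ j • J (b j) = J (∑ j ∈ Finset.range n, θ j • b j) := by
    simp [map_sum]
  rw [hsum]
  clear hsum
  apply hJ'
  have hb : ∀ j i : ℕ, b j i = if ν j ≤ i ∧ i < ν (j + 1) then (1 : 𝕜) else 0 := by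
    intro j i
    simp [b, Finsupp.indicator_apply]
  -- Vanishing beyond ν n is what carries the induction: the next block starts there.
  suffices h : ∀ i, ‖(∑ j ∈ Finset.range n, θ j • b j) i‖ ≤ 1 ∧
      (ν n ≤ i → (∑ j ∈ Finset.range n, θ j • b j) i = 0) from fun i => (h i).1
  intro i
  induction n with
  | zero => simp
  | succ n ih =>
    rw [Finset.sum_range_succ, Finsupp.add_apply, Finsupp.smul_apply, hb]
    have := hν n
    by_cases h1 : ν n ≤ i
    · rw [ih.2 h1, zero_add]
      refine ⟨?_, fun h => by rw [if_neg (by omega), smul_zero]⟩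
      split_ifs
      · simpa using hθ n
      · simp
    · rw [if_neg (by omega), smul_zero, add_zero]
      exact ⟨ih.1, fun h => by omega⟩

/-! ### The Rademacher operator -/

/-- The values on the indicators of the dyadic intervals of the operator on `L¹[0, 1]` that sends
`x` to `∑ j, (∫ x r_j) u j`, where `r_j` are the Rademacher functions. -/
def rademacherTree (𝕜 : Type*) [Field 𝕜] {E : Type*} [AddCommGroup E] [Module 𝕜 E] (u : ℕ → E) :
    ℕ → ℕ → E
  | 0, _ => 0
  | n + 1, k =>
    (1 / 2 : 𝕜) • rademacherTree 𝕜 u n (k / 2) + ((1 / 2 : 𝕜) ^ (n + 1) * (-1) ^ k) • u n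

section RademacherTree

variable {𝕜 : Type*} [RCLike 𝕜] {E : Type*} [NormedAddCommGroup E] [NormedSpace 𝕜 E] (u : ℕ → E)

lemma rademacherTree_eq_add (n k : ℕ) : rademacherTree 𝕜 u n k =
    rademacherTree 𝕜 u (n + 1) (2 * k) + rademacherTree 𝕜 u (n + 1) (2 * k + 1) := by
  have h1 : 2 * k / 2 = k := by omega
  have h2 : (2 * k + 1) / 2 = k := by omega
  simp only [rademacherTree, h1, h2, pow_succ (-1 : 𝕜), pow_mul]
  module

/-- r_j is 1 on left halves and −1 on right halves of the level-j intervals, so this evaluates the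
operator at r_j. -/
lemma sum_rademacherTree_sub (j : ℕ) : ∑ k ∈ Finset.range (2 ^ j),
    (rademacherTree 𝕜 u (j + 1) (2 * k) - rademacherTree 𝕜 u (j + 1) (2 * k + 1)) = u j := by
  have : ∀ k, rademacherTree 𝕜 u (j + 1) (2 * k) - rademacherTree 𝕜 u (j + 1) (2 * k + 1) =
      ((1 / 2 : 𝕜) ^ j) • u j := by
    intro k
    have h1 : 2 * k / 2 = k := by omega
    have h2 : (2 * k + 1) / 2 = k := by omega
    simp only [rademacherTree, h1, h2, pow_succ, pow_mul]
    norm_num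
    module
  rw [Finset.sum_congr rfl fun k _ => this k, Finset.sum_const, Finset.card_range,
    ← Nat.cast_smul_eq_nsmul 𝕜, smul_smul]
  have : ((2 ^ j : ℕ) : 𝕜) * (1 / 2) ^ j = 1 := by
    push_cast
    rw [← mul_pow]
    norm_num
  rw [this, one_smul]

/-- On a level-n interval r_j is constantly ±1 for j < n and has mean 0 for j ≥ n. -/
lemma norm_rademacherTree_le {C : ℝ} (hu : ∀ (θ : ℕ → 𝕜) (n : ℕ), (∀ j, ‖θ j‖ ≤ 1) →
    ‖∑ j ∈ Finset.range n, θ j • u j‖ ≤ C) (n k : ℕ) :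
    ‖rademacherTree 𝕜 u n k‖ ≤ C * (1 / 2) ^ n := by
  have key : ∀ n k, ∃ θ : ℕ → 𝕜, (∀ j, ‖θ j‖ ≤ 1) ∧
      rademacherTree 𝕜 u n k = (1 / 2 : 𝕜) ^ n • ∑ j ∈ Finset.range n, θ j • u j := by
    intro n
    induction n with
    | zero => exact fun k => ⟨0, by simp, by simp [rademacherTree]⟩
    | succ n ih =>
      intro k
      obtain ⟨θ, hθ, h⟩ := ih (k / 2)
      refine ⟨Function.update θ n ((-1) ^ k), fun j => ?_, ?_⟩
      · by_cases hj : j = n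
        · subst hj; simp
        · simpa [Function.update_of_ne hj] using hθ j
      · rw [rademacherTree, h, Finset.sum_range_succ, Function.update_self,
            Finset.sum_congr rfl fun j hj => congrArg (· • u j)
            (Function.update_of_ne (Finset.mem_range.1 hj).ne ((-1) ^ k) θ)]
        rw [smul_add, smul_smul, smul_smul, pow_succ']
  obtain ⟨θ, hθ, h⟩ := key n k
  rw [h, norm_smul, mul_comm]
  have : ‖(1 / 2 : 𝕜) ^ n‖ = (1 / 2) ^ n := by simp
  rw [this]
  gcongr
  exact hu θ n hθ

end RademacherTree

/-! ### Order intervals in L¹(μ) -/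

open Filter Topology in
open scoped ENNReal NNReal in
/-- `L¹` of a `σ`-finite measure is strongly generated by a Hilbert space: a multiplication operator
`L² → L¹` whose images of balls approximate every order interval of `L¹`. -/
lemma exists_Lp_two_approximates_order_intervals (𝕜 : Type*) [RCLike 𝕜] {Ω : Type*}
    [MeasurableSpace Ω] (μ : Measure Ω) [SigmaFinite μ] :
    ∃ Φ : Lp 𝕜 2 μ →L[𝕜] Lp 𝕜 1 μ, ∀ g : Ω → ℝ≥0∞, Measurable g → ∫⁻ x, g x ∂μ ≠ ∞ →
      ∀ ε : ℝ, 0 < ε → ∃ M : ℕ, ∀ w : Lp 𝕜 1 μ, (∀ᵐ x ∂μ, ‖w x‖ₑ ≤ g x) →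
        ∃ f, ‖f‖ ≤ M ∧ ‖w - Φ f‖ ≤ ε := by
  obtain ⟨v, hvpos, hvm, hvint⟩ := exists_pos_lintegral_lt_of_sigmaFinite μ one_ne_zero
  let k : Ω → 𝕜 := fun x => ((NNReal.sqrt (v x) : ℝ) : 𝕜)
  have hkm : Measurable k := by fun_prop
  have hk : ∀ x, ‖k x‖₊ = NNReal.sqrt (v x) := fun x => by
    apply NNReal.eq
    simp [k]
  have hk0 : ∀ x, k x ≠ 0 := fun x => by
    rw [← nnnorm_ne_zero_iff, hk]
    simpa using (hvpos x).ne'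
  have hkL : MemLp k 2 μ := by
    refine ⟨hkm.aestronglyMeasurable, ?_⟩
    rw [eLpNorm_lt_top_iff_lintegral_rpow_enorm_lt_top (by simp) (by simp)]
    refine lt_of_le_of_lt (le_of_eq (lintegral_congr fun x => ?_)) (hvint.trans ENNReal.one_lt_top)
    rw [enorm_eq_nnnorm, hk]
    simp only [ENNReal.toReal_ofNat]
    rw [← ENNReal.coe_rpow_of_nonneg _ (by norm_num)]
    norm_cast
    exact NNReal.sq_sqrt _
  refine ⟨(ContinuousLinearMap.mul 𝕜 𝕜).holderL μ 2 2 1 hkL.toLp, fun g hg hgint ε hε => ?_⟩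
  -- As v = |k|², on A n the quotient w/k is at most n|k|, so it lies in L². Off A n the error is at
  -- most the tail of g, uniformly in w.
  let A : ℕ → Set Ω := fun n => {x | g x ≤ n * v x}
  have hA : ∀ n, MeasurableSet (A n) := fun n => measurableSet_le hg (by fun_prop)
  have hlim : Tendsto (fun n => ∫⁻ x, (A n)ᶜ.indicator g x ∂μ) atTop (𝓝 0) := by
    rw [← lintegral_zero (μ := μ)]
    refine tendsto_lintegral_of_dominated_convergence g (fun n => hg.indicator (hA n).compl)
      (fun n => ae_of_all _ fun x => Set.indicator_le_self _ _ _) hgint ?_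
    filter_upwards [ae_lt_top hg hgint] with x hx
    refine tendsto_const_nhds.congr' ?_
    have hv : (v x : ℝ≥0∞) ≠ 0 := by simpa using (hvpos x).ne'
    obtain ⟨n₀, hn₀⟩ := ENNReal.exists_nat_mul_gt hv hx.ne
    filter_upwards [eventually_ge_atTop n₀] with n hn
    rw [Set.indicator_of_notMem]
    simp only [A, Set.mem_compl_iff, Set.mem_ofPred_eq, not_not]
    exact hn₀.le.trans (by gcongr)
  obtain ⟨n, hn⟩ := ((ENNReal.tendsto_atTop_zero.1 hlim) (ENNReal.ofReal ε) (by simpa using hε))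
  have hn := hn n le_rfl
  obtain ⟨M, hM⟩ := exists_nat_ge (n * ‖hkL.toLp‖)
  refine ⟨M, fun w hw => ?_⟩
  have hwm : AEStronglyMeasurable w μ := Lp.aestronglyMeasurable w
  let f : Ω → 𝕜 := (A n).indicator fun x => w x / k x
  have hfm : AEStronglyMeasurable f μ := by
    refine AEStronglyMeasurable.indicator ?_ (hA n)
    exact (hwm.aemeasurable.div hkm.aemeasurable).aestronglyMeasurable
  have hfle : ∀ᵐ x ∂μ, ‖f x‖ ≤ n * ‖k x‖ := by
    filter_upwards [hw] with x hx
    by_cases hxA : x ∈ A n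
    · have h1 : ‖w x‖ₑ ≤ n * v x := hx.trans hxA
      have h2 : ‖w x‖₊ ≤ n * v x := by
        rw [enorm_eq_nnnorm] at h1
        exact_mod_cast h1
      have h3 : ‖w x‖ ≤ n * (‖k x‖ * ‖k x‖) := by
        have : v x = ‖k x‖₊ * ‖k x‖₊ := by rw [hk, NNReal.mul_self_sqrt]
        rw [this] at h2
        exact_mod_cast h2
      simp only [f, Set.indicator_of_mem hxA, norm_div]
      rw [div_le_iff₀ (norm_pos_iff.2 (hk0 x))]
      linarith
    · simp only [f, Set.indicator_of_notMem hxA, norm_zero]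
      positivity
  have hfL : MemLp f 2 μ := hkL.of_le_mul hfm hfle
  refine ⟨hfL.toLp, (Lp.norm_le_mul_norm_of_ae_le_mul ?_).trans hM, ?_⟩
  · filter_upwards [hfle, hfL.coeFn_toLp, hkL.coeFn_toLp] with x h1 h2 h3
    rwa [h2, h3]
  · rw [Lp.norm_def]
    refine ENNReal.toReal_le_of_le_ofReal hε.le (le_trans ?_ hn)
    rw [eLpNorm_one_eq_lintegral_enorm]
    refine lintegral_mono_ae ?_
    filter_upwards [hw, hfL.coeFn_toLp, hkL.coeFn_toLp,
      (ContinuousLinearMap.mul 𝕜 𝕜).coeFn_holder (r := 1) hkL.toLp hfL.toLp,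
      Lp.coeFn_sub w ((ContinuousLinearMap.mul 𝕜 𝕜).holderL μ 2 2 1 hkL.toLp hfL.toLp)]
      with x hx h1 h2 h3 h4
    rw [h4, Pi.sub_apply]
    have h5 : ((ContinuousLinearMap.mul 𝕜 𝕜).holderL μ 2 2 1 hkL.toLp hfL.toLp) x = k x * f x := by
      rw [← h1, ← h2]
      exact h3
    rw [h5]
    by_cases hxA : x ∈ A n
    · simp [f, Set.indicator_of_mem hxA, mul_div_cancel₀ _ (hk0 x)]
    · have : x ∈ (A n)ᶜ := hxA
      simpa [f, Set.indicator_of_notMem hxA, Set.indicator_of_mem this] using hx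

open scoped ENNReal in
/-- A bounded operator from `L¹[0, 1]` to `L¹(μ)`, given by its values on dyadic intervals, maps the
Rademacher functions to an order bounded sequence. -/
lemma exists_order_bound_of_tree {𝕜 : Type*} [RCLike 𝕜] {Ω : Type*} [MeasurableSpace Ω]
    {μ : Measure Ω} (s : ℕ → ℕ → Lp 𝕜 1 μ) {B : ℝ}
    (hs : ∀ n k, s n k = s (n + 1) (2 * k) + s (n + 1) (2 * k + 1))
    (hB : ∀ n k, ‖s n k‖ ≤ B * (1 / 2) ^ n) :
    ∃ g : Ω → ℝ≥0∞, Measurable g ∧ ∫⁻ x, g x ∂μ ≠ ∞ ∧ ∀ j, ∀ᵐ x ∂μ,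
      ‖(∑ k ∈ Finset.range (2 ^ j), (s (j + 1) (2 * k) - s (j + 1) (2 * k + 1)) : Lp 𝕜 1 μ) x‖ₑ ≤
        g x := by
  -- Increasing in n by the triangle inequality, with integrals at most 2ⁿ · B2⁻ⁿ = B; the supremum
  -- is the order bound.
  let G : ℕ → Ω → ℝ≥0∞ := fun n x => ∑ k ∈ Finset.range (2 ^ n), ‖s n k x‖ₑ
  have hsm : ∀ n k, Measurable (s n k) := fun n k => (Lp.stronglyMeasurable (s n k)).measurable
  have hGm : ∀ n, Measurable (G n) := fun n =>
    Finset.measurable_sum _ fun k _ => (hsm n k).enorm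
  have hpair : ∀ (F : ℕ → ℝ≥0∞) (N : ℕ), ∑ k ∈ Finset.range (2 * N), F k =
      ∑ k ∈ Finset.range N, (F (2 * k) + F (2 * k + 1)) := by
    intro F N
    induction N with
    | zero => simp
    | succ N ih =>
      rw [Finset.sum_range_succ, ← ih, show 2 * (N + 1) = 2 * N + 1 + 1 by ring,
        Finset.sum_range_succ, Finset.sum_range_succ, add_assoc]
  have hGmono : ∀ n, ∀ᵐ x ∂μ, G n x ≤ G n.succ x := by
    intro n
    have : ∀ᵐ x ∂μ, ∀ k, s n k x = s (n + 1) (2 * k) x + s (n + 1) (2 * k + 1) x := by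
      rw [ae_all_iff]
      intro k
      have := Lp.coeFn_add (s (n + 1) (2 * k)) (s (n + 1) (2 * k + 1))
      rw [← hs] at this
      exact this
    filter_upwards [this] with x hx
    simp only [G, Nat.succ_eq_add_one, pow_succ', hpair]
    refine Finset.sum_le_sum fun k _ => ?_
    rw [hx k]
    exact enorm_add_le _ _
  have hint : ∀ n k, ∫⁻ x, ‖s n k x‖ₑ ∂μ = ENNReal.ofReal ‖s n k‖ := by
    intro n k
    rw [← eLpNorm_one_eq_lintegral_enorm, Lp.norm_def,
      ENNReal.ofReal_toReal (Lp.eLpNorm_ne_top _)]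
  have hGint : ∀ n, ∫⁻ x, G n x ∂μ ≤ ENNReal.ofReal B := by
    intro n
    rw [lintegral_finsetSum _ fun k _ => (hsm n k).enorm]
    simp only [hint]
    rw [← ENNReal.ofReal_sum_of_nonneg fun _ _ => norm_nonneg _]
    refine ENNReal.ofReal_le_ofReal ((Finset.sum_le_sum fun k _ => hB n k).trans_eq ?_)
    rw [Finset.sum_const, Finset.card_range, nsmul_eq_mul]
    push_cast
    rw [mul_left_comm, ← mul_pow]
    norm_num
  refine ⟨fun x => ⨆ n, G n x, Measurable.iSup hGm, ?_, fun j => ?_⟩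
  · rw [lintegral_iSup_ae hGm hGmono]
    exact ne_top_of_le_ne_top ENNReal.ofReal_ne_top (iSup_le hGint)
  · have h1 : ∀ᵐ x ∂μ, (∑ k ∈ Finset.range (2 ^ j),
        (s (j + 1) (2 * k) - s (j + 1) (2 * k + 1)) : Lp 𝕜 1 μ) x =
        ∑ k ∈ Finset.range (2 ^ j), (s (j + 1) (2 * k) - s (j + 1) (2 * k + 1) : Lp 𝕜 1 μ) x := by
      filter_upwards [Lp.coeFn_finsetSum (Finset.range (2 ^ j))
        fun k => s (j + 1) (2 * k) - s (j + 1) (2 * k + 1)] with x hx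
      simpa using hx
    have h2 : ∀ᵐ x ∂μ, ∀ k, (s (j + 1) (2 * k) - s (j + 1) (2 * k + 1) : Lp 𝕜 1 μ) x =
        s (j + 1) (2 * k) x - s (j + 1) (2 * k + 1) x :=
      ae_all_iff.2 fun k => Lp.coeFn_sub _ _
    filter_upwards [h1, h2] with x hx1 hx2
    rw [hx1]
    refine (enorm_sum_le _ _).trans (le_trans ?_ (le_iSup (fun n => G n x) (j + 1)))
    simp only [G, pow_succ', hpair]
    refine Finset.sum_le_sum fun k _ => ?_
    rw [hx2 k]
    exact enorm_sub_le

/-! ### The contradiction, and copies of c₀ -/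

/-- The kernel of a quotient map from `L¹(μ)` onto a Banach space in which the finitely supported
sequences with the sup norm embed is not complemented in its second dual. -/
theorem not_complementedInSecondDual_ker {𝕜 : Type*} [RCLike 𝕜] {Ω : Type*} [MeasurableSpace Ω]
    {μ : Measure Ω} [SigmaFinite μ] {E : Type*} [NormedAddCommGroup E] [NormedSpace 𝕜 E]
    [CompleteSpace E] (Q : Lp 𝕜 1 μ →L[𝕜] E) (hQ : Function.Surjective Q)
    (J : (ℕ →₀ 𝕜) →ₗ[𝕜] E) {c C : ℝ} (hc : 0 < c) (hJ : ∀ a i, c * ‖a i‖ ≤ ‖J a‖)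
    (hJ' : ∀ a : ℕ →₀ 𝕜, (∀ i, ‖a i‖ ≤ 1) → ‖J a‖ ≤ C) :
    ¬ ComplementedInSecondDual 𝕜 Q.ker := by
  intro hK
  obtain ⟨D, hD, hlift⟩ := Q.exists_preimage_norm_le hQ
  obtain ⟨Φ, hΦ⟩ := exists_Lp_two_approximates_order_intervals 𝕜 μ
  obtain ⟨u, hu, hfar⟩ := exists_blocks_far_from_image_closedBall J hc hJ hJ' (Q.comp Φ)
  obtain ⟨s, B, hsQ, hs, hsB⟩ := exists_tree_lift Q hK hD.le hlift (rademacherTree 𝕜 u)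
    (rademacherTree_eq_add u) (norm_rademacherTree_le u hu)
  obtain ⟨g, hg, hgint, hle⟩ := exists_order_bound_of_tree s hs hsB
  have hε : 0 < c / (4 * (‖Q‖ + 1)) := by positivity
  obtain ⟨M, hM⟩ := hΦ g hg hgint _ hε
  -- M serves both as the radius of the ball and as the index of the block.
  obtain ⟨f, hfM, hf⟩ := hM _ (hle M)
  have h1 := hfar M f hfM
  have h2 : Q (∑ k ∈ Finset.range (2 ^ M), (s (M + 1) (2 * k) - s (M + 1) (2 * k + 1))) = u M := by
    simp only [map_sum, map_sub, hsQ, sum_rademacherTree_sub]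
  rw [ContinuousLinearMap.comp_apply, ← h2, ← map_sub] at h1
  have h3 := (Q.le_opNorm _).trans (mul_le_mul_of_nonneg_left hf (norm_nonneg Q))
  have h4 : ‖Q‖ * (c / (4 * (‖Q‖ + 1))) ≤ c / 4 := by
    calc ‖Q‖ * (c / (4 * (‖Q‖ + 1))) ≤ (‖Q‖ + 1) * (c / (4 * (‖Q‖ + 1))) := by gcongr; simp
      _ = c / 4 := by field_simp
  linarith

/-- Finitely supported functions on a discrete space, as functions vanishing at infinity. -/
noncomputable def Finsupp.toZeroAtInfty (𝕜 : Type*) [RCLike 𝕜] (A : Type*) [TopologicalSpace A]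
    [DiscreteTopology A] : (A →₀ 𝕜) →ₗ[𝕜] C₀(A, 𝕜) where
  toFun a :=
    { toFun := a
      continuous_toFun := continuous_of_discreteTopology
      zero_at_infty' := by
        rw [Filter.cocompact_eq_cofinite]
        refine tendsto_const_nhds.congr' ?_
        filter_upwards [a.support.finite_toSet.compl_mem_cofinite] with x hx
        simpa [eq_comm] using hx }
  map_add' _ _ := rfl
  map_smul' _ _ := rfl

/-- On an infinite discrete space `A`, `C₀(A)` contains the finitely supported sequences. -/
lemma exists_isometric_finsupp_zeroAtInfty (𝕜 : Type*) [RCLike 𝕜] (A : Type*) [TopologicalSpace A]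
    [DiscreteTopology A] [Infinite A] : ∃ J : (ℕ →₀ 𝕜) →ₗ[𝕜] C₀(A, 𝕜),
      (∀ a i, 1 * ‖a i‖ ≤ ‖J a‖) ∧ ∀ a : ℕ →₀ 𝕜, (∀ i, ‖a i‖ ≤ 1) → ‖J a‖ ≤ 1 := by
  let ι : ℕ ↪ A := Infinite.natEmbedding A
  refine ⟨Finsupp.toZeroAtInfty 𝕜 A ∘ₗ Finsupp.lmapDomain 𝕜 𝕜 ι, fun a i => ?_, fun a ha => ?_⟩
  · have h := (Finsupp.toZeroAtInfty 𝕜 A (Finsupp.lmapDomain 𝕜 𝕜 ι a)).toBCF.norm_coe_le_norm (ι i)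
    rw [ZeroAtInftyContinuousMap.norm_toBCF_eq_norm] at h
    have h2 : (Finsupp.toZeroAtInfty 𝕜 A (Finsupp.lmapDomain 𝕜 𝕜 ι a)).toBCF (ι i) = a i :=
      Finsupp.mapDomain_apply ι.injective a i
    rw [h2] at h
    rwa [one_mul]
  · rw [← ZeroAtInftyContinuousMap.norm_toBCF_eq_norm, BoundedContinuousFunction.norm_le zero_le_one]
    intro x
    change ‖Finsupp.mapDomain ι a x‖ ≤ 1
    by_cases hx : x ∈ Set.range ι
    · obtain ⟨i, rfl⟩ := hx
      rw [Finsupp.mapDomain_apply ι.injective]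
      exact ha i
    · rw [Finsupp.mapDomain_of_notMem_range a x hx, norm_zero]
      exact zero_le_one

/-- A space with a copy of `c₀` contains the finitely supported sequences. -/
lemma ContainsCopyOfCZero.exists_finsupp_embedding {𝕜 : Type*} [RCLike 𝕜] {E : Type*}
    [NormedAddCommGroup E] [NormedSpace 𝕜 E] (h : ContainsCopyOfCZero 𝕜 E) :
    ∃ (J : (ℕ →₀ 𝕜) →ₗ[𝕜] E) (c C : ℝ), 0 < c ∧ (∀ a i, c * ‖a i‖ ≤ ‖J a‖) ∧
      ∀ a : ℕ →₀ 𝕜, (∀ i, ‖a i‖ ≤ 1) → ‖J a‖ ≤ C := by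
  obtain ⟨E₁, ⟨e⟩⟩ := h
  obtain ⟨J, hJ, hJ'⟩ := exists_isometric_finsupp_zeroAtInfty 𝕜 ℕ
  obtain ⟨K, hK, he⟩ := (e : E₁ →L[𝕜] C₀(ℕ, 𝕜)).bound
  obtain ⟨K', hK', he'⟩ := (e.symm : C₀(ℕ, 𝕜) →L[𝕜] E₁).bound
  refine ⟨E₁.subtype ∘ₗ (e.symm : C₀(ℕ, 𝕜) →ₗ[𝕜] E₁) ∘ₗ J, K⁻¹, K', inv_pos.2 hK,
    fun a i => ?_, fun a ha => ?_⟩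
  · have h1 : ‖J a‖ ≤ K * ‖e.symm (J a)‖ := by simpa using he (e.symm (J a))
    have h2 := hJ a i
    rw [one_mul] at h2
    rw [inv_mul_le_iff₀ hK]
    exact h2.trans h1
  · have h1 : ‖e.symm (J a)‖ ≤ K' * ‖J a‖ := he' (J a)
    exact h1.trans (by nlinarith [hJ' a ha])

theorem proposition2p2 {𝕜 : Type*} [RCLike 𝕜] {Ω : Type*} [MeasurableSpace Ω]
    (μ : Measure Ω) [SigmaFinite μ] :
    (∀ (E : Type*) [NormedAddCommGroup E] [NormedSpace 𝕜 E] [CompleteSpace E]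
        (Q : Lp 𝕜 1 μ →L[𝕜] E), Function.Surjective Q → ContainsCopyOfCZero 𝕜 E →
        ¬ ComplementedInSecondDual 𝕜 Q.ker) ∧
      (∀ (A : Type*) [TopologicalSpace A] [DiscreteTopology A] [Infinite A]
        (Q : Lp 𝕜 1 μ →L[𝕜] C₀(A, 𝕜)), Function.Surjective Q →
        ¬ ComplementedInSecondDual 𝕜 Q.ker) := by
  refine ⟨fun E _ _ _ Q hQ hE => ?_, fun A _ _ _ Q hQ => ?_⟩
  · obtain ⟨J, c, C, hc, hJ, hJ'⟩ := hE.exists_finsupp_embedding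
    exact not_complementedInSecondDual_ker Q hQ J hc hJ hJ'
  · obtain ⟨J, hJ, hJ'⟩ := exists_isometric_finsupp_zeroAtInfty 𝕜 A
    exact not_complementedInSecondDual_ker Q hQ J one_pos hJ hJ'
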